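/- Let $c_1,\dots,c_{2n}$ be the Majorana operators on $n$ qubits in the Jordan--Wigner representation, $c_{2q-1}=Z^{\otimes (q-1)}\otimes X\otimes I^{\otimes(n-q)}$ and $c_{2q}=Z^{\otimes (q-1)}\otimes Y\otimes I^{\otimes(n-q)}$. Let $\mathbb{SPIN}(2n)$ be the matchgate group, i.e. the group of $2^n\times 2^n$ matrices generated by the exponentials $e^{\sum_{j\ne k}\alpha_{jk}c_jc_k}$ with $\alpha_{jk}\in\mathbb R$, and let $\mathrm{Ad}_{\mathbb{SPIN}(2n)}=\{U\otimes U^* : U\in\mathbb{SPIN}(2n)\}$, where $U^*$ is the entrywise complex conjugate of $U$. For $j \neq k$ let $L_{jk}$ be the real $2n\times 2n$ matrix with entries $(L_{jk})_{lm}=\delta_{jl}\delta_{km}-\delta_{jm}\delta_{kl}$, and let $\|\cdot\|$ be the operator norm induced by the Euclidean norm. There is exactly one group isomorphism $\Phi:\mathrm{Ad}_{\mathbb{SPIN}(2n)}\to\mathbb{SO}(2n)$ which, for all real $\alpha_{jk}$ ($j\ne k$), sends $U\otimes U^*$ with $U=e^{\sum_{j\ne k}\alpha_{jk}c_jc_k}$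 to $e^{\sum_{j\ne k}2\alpha_{jk}L_{jk}}$. For all $Q,Q_\varepsilon\in\mathbb{SO}(2n)$ with $\|Q-Q_\varepsilon\|=\varepsilon_{\mathbb{SO}(2n)}$ it satisfies $$\|\Phi^{-1}(Q)-\Phi^{-1}(Q_\varepsilon)\|\le \frac{\pi}{2}\,n\,\varepsilon_{\mathbb{SO}(2n)}.$$ -/

import Mathlib

open scoped Matrix Kronecker Matrix.Norms.L2Operator

namespace Matchgate

/-- Basis labels of the Hilbert space of `n` qubits: bit strings of length `n`, so that operators
on `n` qubits are the `2^n × 2^n` matrices indexed by them. -/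
abbrev Qubits (n : ℕ) : Type := Fin n → Fin 2

/-- The Pauli matrix `X`. -/
def pauliX : Matrix (Fin 2) (Fin 2) ℂ := !![0, 1; 1, 0]

/-- The Pauli matrix `Y`. -/
def pauliY : Matrix (Fin 2) (Fin 2) ℂ := !![0, -Complex.I; Complex.I, 0]

/-- The Pauli matrix `Z`. -/
def pauliZ : Matrix (Fin 2) (Fin 2) ℂ := !![1, 0; 0, -1]

/-- The `n`-fold tensor (Kronecker) product `A 0 ⊗ A 1 ⊗ ⋯ ⊗ A (n-1)` of `2 × 2` matrices. -/
def tensor {n : ℕ} (A : Fin n → Matrix (Fin 2) (Fin 2) ℂ) : Matrix (Qubits n) (Qubits n) ℂ :=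
  Matrix.of fun s t => ∏ q, A q (s q) (t q)

/-- The `2n` Majorana operators in the Jordan--Wigner representation, numbered from `0`:
`majorana n (2q)` is `Z ⊗ ⋯ ⊗ Z ⊗ X ⊗ I ⊗ ⋯ ⊗ I` and `majorana n (2q+1)` is
`Z ⊗ ⋯ ⊗ Z ⊗ Y ⊗ I ⊗ ⋯ ⊗ I`, with `X`, `Y` on qubit `q`. -/
def majorana (n : ℕ) (l : Fin (2 * n)) : Matrix (Qubits n) (Qubits n) ℂ :=
  tensor fun q : Fin n =>
    if (q : ℕ) < (l : ℕ) / 2 then pauliZ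
    else if (q : ℕ) = (l : ℕ) / 2 then (if (l : ℕ) % 2 = 0 then pauliX else pauliY)
    else 1

/-- The real linear combination `∑_{j ≠ k} α_{jk} c_j c_k` of products of two distinct Majorana
operators. -/
noncomputable def quadratic (n : ℕ) (α : Fin (2 * n) → Fin (2 * n) → ℝ) :
    Matrix (Qubits n) (Qubits n) ℂ :=
  ∑ p ∈ (Finset.univ : Finset (Fin (2 * n))).offDiag,
    (α p.1 p.2 : ℂ) • (majorana n p.1 * majorana n p.2)

/-- The antisymmetric matrix `L_{jk}`, with entries
`(L_{jk})_{lm} = δ_{jl} δ_{km} - δ_{jm} δ_{kl}`. -/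
def rotGen (n : ℕ) (j k : Fin (2 * n)) : Matrix (Fin (2 * n)) (Fin (2 * n)) ℝ :=
  Matrix.of fun l m =>
    (if j = l then 1 else 0) * (if k = m then 1 else 0)
      - (if j = m then 1 else 0) * (if k = l then 1 else 0)

/-- The real antisymmetric matrix `∑_{j ≠ k} 2 α_{jk} L_{jk}`. -/
noncomputable def rotQuadratic (n : ℕ) (α : Fin (2 * n) → Fin (2 * n) → ℝ) :
    Matrix (Fin (2 * n)) (Fin (2 * n)) ℝ :=
  ∑ p ∈ (Finset.univ : Finset (Fin (2 * n))).offDiag, (2 * α p.1 p.2) • rotGen n p.1 p.2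

/-- The group `SPIN(2n)` of matchgate unitaries on `n` qubits: the group generated by the
exponentials of its Lie algebra, the real span of the products of two distinct Majorana operators.
(The set of these exponentials is closed under inverses, so no inverses have to be added.) -/
noncomputable def spin (n : ℕ) : Submonoid (Matrix (Qubits n) (Qubits n) ℂ) :=
  Submonoid.closure
    (Set.range fun α : Fin (2 * n) → Fin (2 * n) → ℝ => NormedSpace.exp (quadratic n α))

/-- The superoperator form `U ⊗ U*` of the adjoint action `A ↦ U A U†`; here `U*` is the
entrywise complex conjugate of `U`. -/
noncomputable def superop (n : ℕ) :
    Matrix (Qubits n) (Qubits n) ℂ →* Matrix (Qubits n × Qubits n) (Qubits n × Qubits n) ℂ where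
  toFun U := U ⊗ₖ U.map (starRingEnd ℂ)
  map_one' := by
    rw [Matrix.map_one _ (map_zero _) (map_one _), Matrix.one_kronecker_one]
  map_mul' U V := by
    rw [Matrix.map_mul, Matrix.mul_kronecker_mul]

/-- The group `Ad_{SPIN(2n)}` of the superoperators `U ⊗ U*` of matchgate unitaries `U`. -/
noncomputable def adSpin (n : ℕ) :
    Submonoid (Matrix (Qubits n × Qubits n) (Qubits n × Qubits n) ℂ) :=
  (spin n).map (superop n)

/-- The superoperator `U ⊗ U*` of `U = exp (∑ α_{jk} c_j c_k)`, as an element of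
`Ad_{SPIN(2n)}`. -/
noncomputable def adExp (n : ℕ) (α : Fin (2 * n) → Fin (2 * n) → ℝ) : adSpin n :=
  ⟨superop n (NormedSpace.exp (quadratic n α)),
    Submonoid.mem_map_of_mem _ (Submonoid.subset_closure (Set.mem_range_self α))⟩

/-- The defining formula of the isomorphism `Φ` from `Ad_{SPIN(2n)}` to `SO(2n)`: it sends
the superoperator `U ⊗ U*` of `U = exp (∑ α_{jk} c_j c_k)` to `exp (∑ 2 α_{jk} L_{jk})`. -/
def IsPhi (n : ℕ) (Φ : adSpin n ≃* Matrix.specialOrthogonalGroup (Fin (2 * n)) ℝ) : Prop :=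
  ∀ α : Fin (2 * n) → Fin (2 * n) → ℝ,
    (Φ (adExp n α) : Matrix (Fin (2 * n)) (Fin (2 * n)) ℝ) = NormedSpace.exp (rotQuadratic n α)

end Matchgate

namespace Matchgate

/-! ### Tensor products and the Clifford relations -/

/-! Conjugation by a matchgate `U` rotates the real span of the Majorana operators: with `c(x) = ∑
x_l c_l`, there is `Q` in SO(2n) with `U c(x) U† = c(Qx)`. For exponentials this integrates the
commutator `[A, c(x)] = c(Kx)` (`quadratic_comm_cliff`, `implements_exp_of_comm`). Since `U ⊗ U*` is
the matrix of `A ↦ U A U†`, it determines `Q`. Conversely, unitaries implementing the same `Q`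
differ by an operator commuting with every Majorana operator, hence by a phase, which cancels in `U
⊗ U*`. This makes `W ↦ Q` an injective homomorphism, and agreement on exponentials, which generate,
makes it the only candidate for `Φ`.

Surjectivity and the estimate come together from `exists_spin_of_finrank_fixed`. A rotation `R ≠ 1`
turns some plane by an angle `θ`; undoing that turn enlarges the fixed space by two dimensions and
does not increase `‖R - 1‖`. So at most `n` plane rotations suffice. Each is implemented by a
matchgate `cos (θ/2) + sin (θ/2) c(w)c(v)` whose superoperator is within `2|sin (θ/2)| ≤ ‖R - 1‖` of
the identity, and telescoping gives `n ‖R - 1‖`. Unitary invariance of the norm reduces an arbitrary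
pair to this case. The constant obtained is `n`, which is at most `π/2 * n`. -/

theorem tensor_mul {n : ℕ} (A B : Fin n → Matrix (Fin 2) (Fin 2) ℂ) :
    tensor A * tensor B = tensor fun q => A q * B q := by
  ext s t
  simp only [tensor, Matrix.mul_apply, Matrix.of_apply, ← Finset.prod_mul_distrib]
  exact (Fintype.prod_sum fun q j => A q (s q) j * B q j (t q)).symm

theorem tensor_one (n : ℕ) : tensor (fun _ : Fin n => 1) = 1 := by
  ext s t
  simp only [tensor, Matrix.of_apply, Matrix.one_apply, Finset.prod_ite_zero, funext_iff]
  simp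

theorem tensor_smul {n : ℕ} (a : Fin n → ℂ) (A : Fin n → Matrix (Fin 2) (Fin 2) ℂ) :
    tensor (fun q => a q • A q) = (∏ q, a q) • tensor A := by
  ext s t
  simp [tensor, Finset.prod_mul_distrib]

theorem tensor_conjTranspose {n : ℕ} (A : Fin n → Matrix (Fin 2) (Fin 2) ℂ) :
    (tensor A)ᴴ = tensor fun q => (A q)ᴴ := by
  ext s t
  simp [tensor, Matrix.conjTranspose_apply]

theorem pauliX_mul_self : pauliX * pauliX = 1 := by
  simp [pauliX, Matrix.one_fin_two]

theorem pauliY_mul_self : pauliY * pauliY = 1 := by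
  simp [pauliY, Matrix.one_fin_two]

theorem pauliZ_mul_self : pauliZ * pauliZ = 1 := by
  simp [pauliZ, Matrix.one_fin_two]

theorem pauliX_mul_pauliY : pauliX * pauliY = Complex.I • pauliZ := by
  simp [pauliX, pauliY, pauliZ]

theorem pauliY_mul_pauliX : pauliY * pauliX = (-1 : ℂ) • (pauliX * pauliY) := by
  simp [pauliX, pauliY]

theorem pauliX_mul_pauliZ : pauliX * pauliZ = (-1 : ℂ) • (pauliZ * pauliX) := by
  simp [pauliX, pauliZ]

theorem pauliY_mul_pauliZ : pauliY * pauliZ = (-1 : ℂ) • (pauliZ * pauliY) := by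
  simp [pauliY, pauliZ]

theorem majorana_conjTranspose (n : ℕ) (l : Fin (2 * n)) : (majorana n l)ᴴ = majorana n l := by
  have hX : pauliXᴴ = pauliX := by ext i j; fin_cases i <;> fin_cases j <;> simp [pauliX]
  have hY : pauliYᴴ = pauliY := by ext i j; fin_cases i <;> fin_cases j <;> simp [pauliY]
  have hZ : pauliZᴴ = pauliZ := by ext i j; fin_cases i <;> fin_cases j <;> simp [pauliZ]
  rw [majorana, tensor_conjTranspose]
  congr 1
  funext q
  split_ifs <;> simp [hX, hY, hZ]

theorem majorana_mul_self (n : ℕ) (l : Fin (2 * n)) : majorana n l * majorana n l = 1 := by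
  rw [majorana, tensor_mul, ← tensor_one]
  congr 1
  funext q
  split_ifs <;> simp [pauliX_mul_self, pauliY_mul_self, pauliZ_mul_self]

theorem majorana_anticomm_of_lt (n : ℕ) {l m : Fin (2 * n)} (h : l < m) :
    majorana n l * majorana n m = - (majorana n m * majorana n l) := by
  have hl : (l : ℕ) / 2 < n := by omega
  have hlm : (l : ℕ) < m := h
  -- Swapping the two factors costs a sign on exactly one qubit, the one where the smaller index `l`
  -- has its `X` or `Y`: there `m` has a `Z`, or the `Y` facing the `X`.
  have key : ∀ q : Fin n, ((if (q : ℕ) < (l : ℕ) / 2 then pauliZ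
      else if (q : ℕ) = (l : ℕ) / 2 then (if (l : ℕ) % 2 = 0 then pauliX else pauliY)
      else 1) * (if (q : ℕ) < (m : ℕ) / 2 then pauliZ
      else if (q : ℕ) = (m : ℕ) / 2 then (if (m : ℕ) % 2 = 0 then pauliX else pauliY)
      else 1)) = (if q = ⟨(l : ℕ) / 2, hl⟩ then (-1 : ℂ) else 1) •
      ((if (q : ℕ) < (m : ℕ) / 2 then pauliZ
      else if (q : ℕ) = (m : ℕ) / 2 then (if (m : ℕ) % 2 = 0 then pauliX else pauliY)
      else 1) * (if (q : ℕ) < (l : ℕ) / 2 then pauliZ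
      else if (q : ℕ) = (l : ℕ) / 2 then (if (l : ℕ) % 2 = 0 then pauliX else pauliY)
      else 1)) := by
    intro q
    simp only [Fin.ext_iff]
    split_ifs <;> first
      | omega
      | simp [pauliX_mul_pauliZ, pauliY_mul_pauliZ, pauliY_mul_pauliX]
  rw [majorana, majorana, tensor_mul, tensor_mul]
  simp only [key]
  rw [tensor_smul]
  simp

theorem majorana_anticomm (n : ℕ) (l m : Fin (2 * n)) :
    majorana n l * majorana n m + majorana n m * majorana n l =
      (if l = m then (2 : ℝ) else 0) • (1 : Matrix (Qubits n) (Qubits n) ℂ) := by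
  rcases lt_trichotomy l m with h | rfl | h
  · rw [majorana_anticomm_of_lt n h, if_neg h.ne]; simp
  · rw [majorana_mul_self, if_pos rfl, two_smul]
  · rw [majorana_anticomm_of_lt n h, if_neg h.ne']; simp

/-- The real linear combination `∑ x_l c_l` of Majorana operators. -/
noncomputable def cliff (n : ℕ) : (Fin (2 * n) → ℝ) →ₗ[ℝ] Matrix (Qubits n) (Qubits n) ℂ :=
  Fintype.linearCombination ℝ (majorana n)

theorem cliff_apply (n : ℕ) (x : Fin (2 * n) → ℝ) : cliff n x = ∑ l, x l • majorana n l :=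
  Fintype.linearCombination_apply ..

theorem cliff_single (n : ℕ) (l : Fin (2 * n)) : cliff n (Pi.single l 1) = majorana n l := by
  simp [cliff]

theorem cliff_conjTranspose (n : ℕ) (x : Fin (2 * n) → ℝ) : (cliff n x)ᴴ = cliff n x := by
  simp [cliff_apply, Matrix.conjTranspose_sum, majorana_conjTranspose]

theorem cliff_mul_cliff (n : ℕ) (x y : Fin (2 * n) → ℝ) :
    cliff n x * cliff n y = ∑ l, ∑ m, (x l * y m) • (majorana n l * majorana n m) := by
  simp only [cliff_apply, Finset.sum_mul, Finset.mul_sum, smul_mul_smul_comm]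
  exact Finset.sum_comm

theorem cliff_anticomm (n : ℕ) (x y : Fin (2 * n) → ℝ) :
    cliff n x * cliff n y + cliff n y * cliff n x = (2 * (x ⬝ᵥ y)) • 1 := by
  have h : ∑ l, ∑ m, (y l * x m) • (majorana n l * majorana n m) =
      ∑ l, ∑ m, (x l * y m) • (majorana n m * majorana n l) := by
    rw [Finset.sum_comm]
    exact Finset.sum_congr rfl fun l _ => Finset.sum_congr rfl fun m _ => by rw [mul_comm]
  rw [cliff_mul_cliff, cliff_mul_cliff, h]
  simp only [← Finset.sum_add_distrib, ← smul_add, majorana_anticomm, smul_smul]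
  simp only [← Finset.sum_smul, dotProduct, Finset.mul_sum]
  congr 1
  simp [mul_comm]

theorem cliff_mul_self (n : ℕ) (x : Fin (2 * n) → ℝ) :
    cliff n x * cliff n x = (x ⬝ᵥ x) • 1 := by
  have h := cliff_anticomm n x x
  rw [← two_smul ℝ, mul_smul] at h
  exact smul_right_injective _ (two_ne_zero (α := ℝ)) h

theorem cliff_mul_comm (n : ℕ) (x y : Fin (2 * n) → ℝ) :
    cliff n x * cliff n y = (2 * (x ⬝ᵥ y)) • 1 - cliff n y * cliff n x := by
  rw [← cliff_anticomm]; abel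

/-- The square of `c(x)` is `|x|²`, so it vanishes only with `x`. -/
theorem cliff_injective (n : ℕ) : Function.Injective (cliff n) := by
  rw [← LinearMap.ker_eq_bot, LinearMap.ker_eq_bot']
  intro x hx
  have h := cliff_mul_self n x
  rw [hx, zero_mul, eq_comm, smul_eq_zero] at h
  exact dotProduct_self_eq_zero.1 (h.resolve_right one_ne_zero)

/-! ### The irreducibility of the Majorana operators -/

/-- The product of the two Majorana operators on qubit `q` is `i` times the operator `Z` there. -/
theorem majorana_mul_majorana_succ (n : ℕ) (q : Fin n) :
    majorana n ⟨2 * q, by omega⟩ * majorana n ⟨2 * q + 1, by omega⟩ =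
      Complex.I • tensor (fun p => if p = q then pauliZ else 1) := by
  have hI : Complex.I = ∏ p : Fin n, if p = q then Complex.I else 1 := by simp
  rw [majorana, majorana, tensor_mul]
  conv_rhs => rw [hI]
  rw [← tensor_smul]
  congr 1
  funext p
  simp only [Fin.ext_iff]
  have h1 : (2 * (q : ℕ)) / 2 = q := by omega
  have h2 : (2 * (q : ℕ) + 1) / 2 = q := by omega
  have h3 : (2 * (q : ℕ) + 1) % 2 = 1 := by omega
  simp only [h1, h2, h3]
  split_ifs <;> first
    | omega
    | contradiction
    | simp [pauliX_mul_pauliY, pauliZ_mul_self]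

theorem tensor_pauliZ (n : ℕ) (q : Fin n) :
    tensor (fun p => if p = q then pauliZ else 1) =
      Matrix.diagonal fun s : Qubits n => if s q = 0 then (1 : ℂ) else -1 := by
  have hZ : pauliZ = Matrix.diagonal fun i => if i = 0 then (1 : ℂ) else -1 := by
    ext i j; fin_cases i <;> fin_cases j <;> simp [pauliZ]
  ext s t
  simp only [tensor, Matrix.of_apply]
  by_cases hst : s = t
  · subst hst
    rw [Finset.prod_eq_single q (by intro p _ hp; simp [hp]) (by simp)]
    simp [hZ]
  · obtain ⟨p, hp⟩ := Function.ne_iff.1 hst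
    rw [Matrix.diagonal_apply_ne _ hst]
    refine Finset.prod_eq_zero (Finset.mem_univ p) ?_
    split_ifs <;> simp [hZ, hp]

/-- Commuting with the products `c_{2q-1} c_{2q}` means commuting with every single-qubit `Z`, and
these diagonal matrices separate bit strings. -/
theorem eq_zero_of_commute_majorana {n : ℕ} {V : Matrix (Qubits n) (Qubits n) ℂ}
    (hV : ∀ l, Commute V (majorana n l)) {s t : Qubits n} (hst : s ≠ t) : V s t = 0 := by
  obtain ⟨q, hq⟩ := Function.ne_iff.1 hst
  have h := ((hV ⟨2 * q, by omega⟩).mul_right (hV ⟨2 * q + 1, by omega⟩)).eq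
  rw [majorana_mul_majorana_succ, tensor_pauliZ, Matrix.mul_smul, Matrix.smul_mul] at h
  have h := congr_fun₂ (smul_right_injective _ Complex.I_ne_zero h) s t
  simp only [Matrix.mul_diagonal, Matrix.diagonal_mul] at h
  have hs : s q = 0 ∨ s q = 1 := by omega
  have ht : t q = 0 ∨ t q = 1 := by omega
  rcases hs with hs | hs <;> rcases ht with ht | ht <;> simp [hs, ht] at h hq ⊢ <;> grind

theorem majorana_apply_update_ne_zero (n : ℕ) (q : Fin n) (s : Qubits n) :
    majorana n ⟨2 * q, by omega⟩ s (Function.update s q (1 - s q)) ≠ 0 := by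
  simp only [majorana, tensor, Matrix.of_apply]
  refine Finset.prod_ne_zero_iff.2 fun p _ => ?_
  have h1 : (2 * (q : ℕ)) / 2 = q := by omega
  have h2 : (2 * (q : ℕ)) % 2 = 0 := by omega
  simp only [h1, h2]
  rcases eq_or_ne p q with rfl | hp
  · have hs : s p = 0 ∨ s p = 1 := by omega
    rcases hs with hs | hs <;> simp [hs, pauliX]
  · have hpq : (p : ℕ) ≠ q := fun h => hp (Fin.ext h)
    have hs : s p = 0 ∨ s p = 1 := by omega
    rw [Function.update_of_ne hp]
    split_ifs <;> rcases hs with hs | hs <;> simp [hs, pauliZ]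

/-- Since `V` is diagonal, comparing one entry of `V c = c V` equates two diagonal entries of `V`,
provided that entry of `c` is nonzero; the Majorana operator with `X` on qubit `q` links a string to
its flip at `q`. -/
theorem apply_update_of_commute_majorana {n : ℕ} {V : Matrix (Qubits n) (Qubits n) ℂ}
    (hV : ∀ l, Commute V (majorana n l)) (q : Fin n) (s : Qubits n) :
    V s s = V (Function.update s q (1 - s q)) (Function.update s q (1 - s q)) := by
  have h := congr_fun₂ (hV ⟨2 * q, by omega⟩).eq s (Function.update s q (1 - s q))
  rw [Matrix.mul_apply, Matrix.mul_apply, Finset.sum_eq_single s, Finset.sum_eq_single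
    (Function.update s q (1 - s q)), mul_comm] at h
  · exact mul_left_cancel₀ (majorana_apply_update_ne_zero n q s) h
  · intro t _ ht; rw [eq_zero_of_commute_majorana hV ht, mul_zero]
  · simp
  · intro t _ ht; rw [eq_zero_of_commute_majorana hV ht.symm, zero_mul]
  · simp

/-- A Schur lemma by hand: `V` is diagonal, and bit flips connect every string to the zero string.
-/
theorem exists_eq_smul_one_of_commute_majorana {n : ℕ} {V : Matrix (Qubits n) (Qubits n) ℂ}
    (hV : ∀ l, Commute V (majorana n l)) : ∃ a : ℂ, V = a • 1 := by
  have hupd : ∀ (s : Qubits n) (q : Fin n) (b : Fin 2),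
      V (Function.update s q b) (Function.update s q b) = V s s := by
    intro s q b
    by_cases hb : b = s q
    · rw [hb, Function.update_eq_self]
    · have : b = 1 - s q := by omega
      rw [this, ← apply_update_of_commute_majorana hV]
  have hconst : ∀ (S : Finset (Fin n)) (s : Qubits n),
      V (S.piecewise s 0) (S.piecewise s 0) = V 0 0 := by
    intro S s
    induction S using Finset.induction_on with
    | empty => simp
    | insert q S _ ih => rw [Finset.piecewise_insert, hupd, ih]
  refine ⟨V 0 0, ?_⟩
  ext s t
  by_cases hst : s = t
  · subst hst
    have := hconst Finset.univ s
    simp only [Finset.piecewise_univ] at this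
    simp [this]
  · simp [eq_zero_of_commute_majorana hV hst, hst]

/-! ### The action of matchgates on Majorana operators -/

/-- Conjugation by `U` acts on the span of the Majorana operators as the matrix `Q`. -/
def Implements {n : ℕ} (U : Matrix (Qubits n) (Qubits n) ℂ)
    (Q : Matrix (Fin (2 * n)) (Fin (2 * n)) ℝ) : Prop :=
  ∀ x, U * cliff n x = cliff n (Q *ᵥ x) * U

namespace Implements

variable {n : ℕ} {U V : Matrix (Qubits n) (Qubits n) ℂ}
  {Q R : Matrix (Fin (2 * n)) (Fin (2 * n)) ℝ}

theorem one : Implements (1 : Matrix (Qubits n) (Qubits n) ℂ) 1 := fun x => by simp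

theorem mul (hU : Implements U Q) (hV : Implements V R) : Implements (U * V) (Q * R) := fun x => by
  rw [mul_assoc, hV, ← mul_assoc, hU, mul_assoc, Matrix.mulVec_mulVec]

theorem conj_eq (h : Implements U Q) (hU : U ∈ unitary (Matrix (Qubits n) (Qubits n) ℂ))
    (x : Fin (2 * n) → ℝ) : U * cliff n x * Uᴴ = cliff n (Q *ᵥ x) := by
  rw [h, mul_assoc, ← Matrix.star_eq_conjTranspose, Unitary.mul_star_self_of_mem hU, mul_one]

theorem conj_eq' (h : Implements U Q) (hU : U ∈ unitary (Matrix (Qubits n) (Qubits n) ℂ))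
    (x : Fin (2 * n) → ℝ) : Uᴴ * cliff n (Q *ᵥ x) = cliff n x * Uᴴ := by
  rw [← h.conj_eq hU, ← mul_assoc, ← mul_assoc, ← Matrix.star_eq_conjTranspose,
    Unitary.star_mul_self_of_mem hU, one_mul]

end Implements

/-- This is why equal superoperators act equally by conjugation. -/
theorem conj_apply_eq_sum_superop {n : ℕ} (U A : Matrix (Qubits n) (Qubits n) ℂ)
    (i j : Qubits n) :
    (U * A * Uᴴ) i j = ∑ p : Qubits n × Qubits n, superop n U (i, j) p * A p.1 p.2 := by
  simp only [Matrix.mul_apply, Finset.sum_mul, Fintype.sum_prod_type]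
  rw [Finset.sum_comm]
  refine Finset.sum_congr rfl fun k _ => Finset.sum_congr rfl fun l _ => ?_
  simp [superop, Matrix.conjTranspose_apply, Matrix.kroneckerMap_apply]
  ring

theorem superop_mem_unitary {n : ℕ} {U : Matrix (Qubits n) (Qubits n) ℂ}
    (hU : U ∈ unitary (Matrix (Qubits n) (Qubits n) ℂ)) :
    superop n U ∈ unitary (Matrix (Qubits n × Qubits n) (Qubits n × Qubits n) ℂ) :=
  Matrix.kronecker_mem_unitary hU (Matrix.map_star_mem_unitaryGroup_iff.2 hU)

namespace Implements

variable {n : ℕ} {U V : Matrix (Qubits n) (Qubits n) ℂ}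
  {Q R : Matrix (Fin (2 * n)) (Fin (2 * n)) ℝ}

theorem eq_of_superop_eq (hU : Implements U Q) (hV : Implements V R)
    (hUu : U ∈ unitary (Matrix (Qubits n) (Qubits n) ℂ))
    (hVu : V ∈ unitary (Matrix (Qubits n) (Qubits n) ℂ))
    (h : superop n U = superop n V) : Q = R := by
  refine Matrix.ext_of_mulVec_single fun i => cliff_injective n ?_
  rw [← hU.conj_eq hUu, ← hV.conj_eq hVu]
  ext j k
  rw [conj_apply_eq_sum_superop, conj_apply_eq_sum_superop, h]

theorem superop_eq_of_eq (hU : Implements U Q) (hV : Implements V Q)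
    (hUu : U ∈ unitary (Matrix (Qubits n) (Qubits n) ℂ))
    (hVu : V ∈ unitary (Matrix (Qubits n) (Qubits n) ℂ)) :
    superop n U = superop n V := by
  obtain ⟨a, ha⟩ := exists_eq_smul_one_of_commute_majorana (V := Uᴴ * V) fun l => by
    rw [← cliff_single, commute_iff_eq, mul_assoc, hV, ← mul_assoc, hU.conj_eq' hUu, mul_assoc]
  have hVU : V = a • U := by
    have := congrArg (U * ·) ha
    simpa [← mul_assoc, ← Matrix.star_eq_conjTranspose, Unitary.mul_star_self_of_mem hUu] using this
  have haa : a * (starRingEnd ℂ) a = 1 := by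
    have h := Unitary.mul_star_self_of_mem hVu
    rw [hVU, star_smul, smul_mul_smul_comm, Unitary.mul_star_self_of_mem hUu] at h
    simpa using congr_fun₂ h 0 0
  have hmap : (a • U).map (starRingEnd ℂ) = (starRingEnd ℂ) a • U.map (starRingEnd ℂ) := by
    ext; simp
  change _ = V ⊗ₖ V.map (starRingEnd ℂ)
  rw [hVU, hmap, Matrix.smul_kronecker, Matrix.kronecker_smul, smul_smul, haa, one_smul]
  rfl

end Implements

/-! ### Exponentials of quadratic forms in the Majorana operators -/

theorem cliff_mul_cliff_comm_cliff (n : ℕ) (u v x : Fin (2 * n) → ℝ) :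
    cliff n u * cliff n v * cliff n x - cliff n x * (cliff n u * cliff n v) =
      cliff n ((2 * (v ⬝ᵥ x)) • u - (2 * (u ⬝ᵥ x)) • v) := by
  rw [mul_assoc, cliff_mul_comm n v x, mul_sub, ← mul_assoc (cliff n u), cliff_mul_comm n u x,
    sub_mul, map_sub, map_smul, map_smul, mul_smul_comm, smul_mul_assoc, mul_one, one_mul,
    mul_assoc]
  abel

theorem rotGen_mulVec (n : ℕ) (j k : Fin (2 * n)) (x : Fin (2 * n) → ℝ) :
    rotGen n j k *ᵥ x = x k • Pi.single j 1 - x j • Pi.single k 1 := by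
  ext l
  simp only [rotGen, Matrix.mulVec, dotProduct, Matrix.of_apply, sub_mul, Finset.sum_sub_distrib]
  simp [Pi.single_apply, eq_comm]

/-- The commutator of `c_j c_k` with `c(x)` is `2 (x_k c_j - x_j c_k)`, which is where the factor 2
in front of `L_{jk}` comes from. -/
theorem quadratic_comm_cliff (n : ℕ) (α : Fin (2 * n) → Fin (2 * n) → ℝ)
    (x : Fin (2 * n) → ℝ) :
    quadratic n α * cliff n x - cliff n x * quadratic n α = cliff n (rotQuadratic n α *ᵥ x) := by
  simp only [quadratic, rotQuadratic, Finset.sum_mul, Finset.mul_sum, Matrix.sum_mulVec, map_sum,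
    ← Finset.sum_sub_distrib]
  refine Finset.sum_congr rfl fun p _ => ?_
  rw [smul_mul_assoc, mul_smul_comm, ← smul_sub, ← cliff_single, ← cliff_single,
    cliff_mul_cliff_comm_cliff, Matrix.smul_mulVec, rotGen_mulVec, Complex.coe_smul,
    ← map_smul]
  congr 1
  simp only [single_dotProduct, one_mul]
  module

theorem quadratic_mem_skewAdjoint (n : ℕ) (α : Fin (2 * n) → Fin (2 * n) → ℝ) :
    quadratic n α ∈ skewAdjoint (Matrix (Qubits n) (Qubits n) ℂ) := by
  refine sum_mem fun p hp => ?_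
  have hne : p.1 ≠ p.2 := (Finset.mem_offDiag.1 hp).2.2
  have h := majorana_anticomm n p.1 p.2
  rw [if_neg hne, zero_smul, add_comm] at h
  rw [skewAdjoint.mem_iff, star_smul, Matrix.star_eq_conjTranspose, Matrix.conjTranspose_mul,
    majorana_conjTranspose, majorana_conjTranspose, eq_neg_of_add_eq_zero_left h]
  simp

theorem exp_quadratic_mem_unitary (n : ℕ) (α : Fin (2 * n) → Fin (2 * n) → ℝ) :
    NormedSpace.exp (quadratic n α) ∈ unitary (Matrix (Qubits n) (Qubits n) ℂ) := by
  let _ : NormedAlgebra ℚ (Matrix (Qubits n) (Qubits n) ℂ) := .restrictScalars ℚ ℝ _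
  exact NormedSpace.exp_mem_unitary_of_mem_skewAdjoint (quadratic_mem_skewAdjoint n α)

theorem implements_exp_of_comm {n : ℕ} {A : Matrix (Qubits n) (Qubits n) ℂ}
    {K : Matrix (Fin (2 * n)) (Fin (2 * n)) ℝ}
    (h : ∀ x, A * cliff n x - cliff n x * A = cliff n (K *ᵥ x)) :
    Implements (NormedSpace.exp A) (NormedSpace.exp K) := by
  intro x
  let T : Matrix (Fin (2 * n)) (Fin (2 * n)) ℝ →ₗ[ℝ] Matrix (Qubits n) (Qubits n) ℂ :=
    cliff n ∘ₗ (Matrix.mulVecBilin ℝ ℝ).flip x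
  have hT : ∀ M, T M = cliff n (M *ᵥ x) := fun M => rfl
  -- The path `e^{-tA} c(e^{tK} x) e^{tA}` is constant: its derivative is the commutator hypothesis
  -- at `e^{tK} x`, sandwiched between exponentials. Comparing `t = 0` and `t = 1` gives the claim.
  let f : ℝ → Matrix (Qubits n) (Qubits n) ℂ := fun t =>
    NormedSpace.exp (t • (-A)) * T (NormedSpace.exp (t • K)) * NormedSpace.exp (t • A)
  have hf : ∀ t, HasDerivAt f 0 t := by
    intro t
    have h1 := hasDerivAt_exp_smul_const (𝕂 := ℝ) (-A) t
    have h2 := hasDerivAt_exp_smul_const' (𝕂 := ℝ) K t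
    have h3 := hasDerivAt_exp_smul_const' (𝕂 := ℝ) A t
    have h4 := T.toContinuousLinearMap.hasFDerivAt.comp_hasDerivAt t h2
    refine ((h1.mul h4).mul h3).congr_deriv ?_
    simp only [Function.comp_def, Pi.mul_apply, LinearMap.coe_toContinuousLinearMap']
    rw [hT, hT, ← Matrix.mulVec_mulVec, ← h]
    noncomm_ring
  have hconst : f 1 = f 0 :=
    is_const_of_deriv_eq_zero (fun t => (hf t).differentiableAt) (fun t => (hf t).deriv) 1 0
  have hinv : NormedSpace.exp A * NormedSpace.exp (-A) = 1 := by
    rw [← Matrix.exp_add_of_commute _ _ (Commute.refl A).neg_right, add_neg_cancel,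
      NormedSpace.exp_zero]
  simp only [f, hT, one_smul, zero_smul, NormedSpace.exp_zero, one_mul, mul_one,
    Matrix.one_mulVec] at hconst
  rw [← hconst, ← mul_assoc, ← mul_assoc, hinv, one_mul]

theorem implements_exp_quadratic (n : ℕ) (α : Fin (2 * n) → Fin (2 * n) → ℝ) :
    Implements (NormedSpace.exp (quadratic n α)) (NormedSpace.exp (rotQuadratic n α)) :=
  implements_exp_of_comm (quadratic_comm_cliff n α)

theorem rotQuadratic_transpose (n : ℕ) (α : Fin (2 * n) → Fin (2 * n) → ℝ) :
    (rotQuadratic n α)ᵀ = -rotQuadratic n α := by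
  simp only [rotQuadratic, Matrix.transpose_sum, ← Finset.sum_neg_distrib]
  refine Finset.sum_congr rfl fun p _ => ?_
  ext l m
  simp only [rotGen, Matrix.transpose_apply, Matrix.smul_apply, Matrix.neg_apply, Matrix.of_apply,
    smul_eq_mul]
  ring

theorem exp_mem_specialOrthogonalGroup {m : Type*} [Fintype m] [DecidableEq m]
    {K : Matrix m m ℝ} (hK : Kᵀ = -K) :
    NormedSpace.exp K ∈ Matrix.specialOrthogonalGroup m ℝ := by
  have orth : ∀ L : Matrix m m ℝ, Lᵀ = -L → NormedSpace.exp L * (NormedSpace.exp L)ᵀ = 1 := by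
    intro L hL
    rw [← Matrix.exp_transpose, hL, ← Matrix.exp_add_of_commute _ _ (Commute.refl L).neg_right,
      add_neg_cancel, NormedSpace.exp_zero]
  refine Matrix.mem_specialOrthogonalGroup_iff.2
    ⟨(Matrix.mem_orthogonalGroup_iff _ _).2 (orth K hK), ?_⟩
  -- Orthogonality only gives determinant ±1; being the square of the orthogonal matrix `exp (K/2)`
  -- fixes the sign.
  have hhalf : NormedSpace.exp K =
      NormedSpace.exp ((1 / 2 : ℝ) • K) * NormedSpace.exp ((1 / 2 : ℝ) • K) := by
    rw [← Matrix.exp_add_of_commute _ _ (Commute.refl _), ← add_smul]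
    norm_num
  have h := congrArg Matrix.det (orth ((1 / 2 : ℝ) • K) (by rw [Matrix.transpose_smul, hK, smul_neg]))
  rwa [Matrix.det_mul, Matrix.det_transpose, Matrix.det_one, ← Matrix.det_mul, ← hhalf] at h

theorem spin_le_unitary (n : ℕ) : spin n ≤ unitary (Matrix (Qubits n) (Qubits n) ℂ) :=
  Submonoid.closure_le.2 (Set.range_subset_iff.2 (exp_quadratic_mem_unitary n))

theorem exp_quadratic_mem_spin (n : ℕ) (α : Fin (2 * n) → Fin (2 * n) → ℝ) :
    NormedSpace.exp (quadratic n α) ∈ spin n :=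
  Submonoid.subset_closure (Set.mem_range_self α)

theorem exists_implements_of_mem_spin {n : ℕ} {U : Matrix (Qubits n) (Qubits n) ℂ}
    (hU : U ∈ spin n) :
    ∃ Q ∈ Matrix.specialOrthogonalGroup (Fin (2 * n)) ℝ, Implements U Q := by
  induction hU using Submonoid.closure_induction with
  | mem U hU =>
    obtain ⟨α, rfl⟩ := hU
    exact ⟨_, exp_mem_specialOrthogonalGroup (rotQuadratic_transpose n α),
      implements_exp_quadratic n α⟩
  | one => exact ⟨1, one_mem _, .one⟩
  | mul U V _ _ hU hV =>
    obtain ⟨Q, hQ, hUQ⟩ := hU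
    obtain ⟨R, hR, hVR⟩ := hV
    exact ⟨Q * R, mul_mem hQ hR, hUQ.mul hVR⟩

/-! ### Rotations in a plane -/

/-- The rotation by `θ` in the plane spanned by the orthonormal vectors `v` and `w`. -/
noncomputable def planeRot {m : Type*} [DecidableEq m] (v w : m → ℝ) (θ : ℝ) :
    Matrix m m ℝ :=
  1 + (Real.cos θ - 1) • (Matrix.vecMulVec v v + Matrix.vecMulVec w w) +
    Real.sin θ • (Matrix.vecMulVec w v - Matrix.vecMulVec v w)

theorem planeRot_mulVec {m : Type*} [Fintype m] [DecidableEq m] (v w : m → ℝ) (θ : ℝ)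
    (x : m → ℝ) :
    planeRot v w θ *ᵥ x = x + ((Real.cos θ - 1) * (v ⬝ᵥ x) - Real.sin θ * (w ⬝ᵥ x)) • v +
      ((Real.cos θ - 1) * (w ⬝ᵥ x) + Real.sin θ * (v ⬝ᵥ x)) • w := by
  simp only [planeRot, Matrix.add_mulVec, Matrix.sub_mulVec, Matrix.smul_mulVec,
    Matrix.vecMulVec_mulVec, Matrix.one_mulVec, op_smul_eq_smul]
  module

theorem planeRot_transpose {m : Type*} [DecidableEq m] (v w : m → ℝ) (θ : ℝ) :
    (planeRot v w θ)ᵀ = planeRot v w (-θ) := by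
  simp only [planeRot, Matrix.transpose_add, Matrix.transpose_sub, Matrix.transpose_smul,
    Matrix.transpose_vecMulVec, Matrix.transpose_one, Real.cos_neg, Real.sin_neg]
  module

/-- Euler's formula, transported along the algebra map from `ℂ` that sends `i` to `J`. -/
theorem exp_smul_of_mul_self_eq_neg_one {A : Type*} [NormedRing A] [NormedAlgebra ℝ A]
    {J : A} (hJ : J * J = -1) (t : ℝ) :
    NormedSpace.exp (t • J) = Real.cos t • 1 + Real.sin t • J := by
  let φ : ℂ →ₐ[ℝ] A := Complex.lift ⟨J, hJ⟩
  have hφ : ∀ z : ℂ, φ z = z.re • 1 + z.im • J := fun z => by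
    simp [φ, Complex.liftAux_apply, Algebra.algebraMap_eq_smul_one]
  have hcont : Continuous φ := φ.toLinearMap.continuous_of_finiteDimensional
  have h : t • J = φ (t * Complex.I) := by simp [hφ]
  let _ : NormedAlgebra ℚ A := .restrictScalars ℚ ℝ A
  rw [h, ← NormedSpace.map_exp φ hcont, ← Complex.exp_eq_exp_ℂ, hφ]
  simp [Complex.exp_ofReal_mul_I_re, Complex.exp_ofReal_mul_I_im]

section

variable {n : ℕ} {v w : Fin (2 * n) → ℝ}

theorem cliff_mul_cliff_mul_self (hv : v ⬝ᵥ v = 1) (hw : w ⬝ᵥ w = 1) (hvw : v ⬝ᵥ w = 0) :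
    cliff n w * cliff n v * (cliff n w * cliff n v) = -1 := by
  have h := cliff_mul_comm n v w
  have hv' := cliff_mul_self n v
  have hw' := cliff_mul_self n w
  rw [hvw, mul_zero, zero_smul, zero_sub] at h
  rw [hv, one_smul] at hv'
  rw [hw, one_smul] at hw'
  rw [mul_assoc, ← mul_assoc (cliff n v), h, neg_mul, mul_neg, mul_assoc, hv', mul_one, hw']

theorem star_cliff_mul_cliff (hvw : v ⬝ᵥ w = 0) :
    star (cliff n w * cliff n v) = -(cliff n w * cliff n v) := by
  have h := cliff_mul_comm n v w
  rw [hvw, mul_zero, zero_smul, zero_sub] at h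
  rw [Matrix.star_eq_conjTranspose, Matrix.conjTranspose_mul, cliff_conjTranspose,
    cliff_conjTranspose, h]

/-- The diagonal terms missing from `quadratic` would add up to a multiple of `w ⬝ᵥ v`, so
orthogonality makes their omission harmless. -/
theorem quadratic_eq_smul_cliff_mul_cliff (hvw : v ⬝ᵥ w = 0) (t : ℝ) :
    quadratic n (fun j k => t * (w j * v k)) = t • (cliff n w * cliff n v) := by
  rw [cliff_mul_cliff, quadratic, Finset.smul_sum]
  simp only [Finset.smul_sum, smul_smul, Complex.coe_smul]
  rw [← Finset.sum_product', ← Finset.diag_union_offDiag,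
    Finset.sum_union (Finset.disjoint_diag_offDiag _), Finset.sum_diag]
  simp only [majorana_mul_self, ← Finset.sum_smul, ← Finset.mul_sum]
  have : ∑ i, w i * v i = 0 := by rw [dotProduct_comm] at hvw; exact hvw
  rw [this, mul_zero, zero_smul, zero_add]

theorem implements_planeRot (hv : v ⬝ᵥ v = 1) (hw : w ⬝ᵥ w = 1) (hvw : v ⬝ᵥ w = 0) (θ : ℝ) :
    Implements (Real.cos (θ / 2) • 1 + Real.sin (θ / 2) • (cliff n w * cliff n v))
      (planeRot v w θ) := by
  intro x
  have hvv := cliff_mul_self n v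
  have hww := cliff_mul_self n w
  have hswap := cliff_mul_comm n v w
  rw [hv, one_smul] at hvv
  rw [hw, one_smul] at hww
  rw [hvw, mul_zero, zero_smul, zero_sub] at hswap
  have h1 : cliff n v * (cliff n w * cliff n v) = - cliff n w := by
    rw [← mul_assoc, hswap, neg_mul, mul_assoc, hvv, mul_one]
  have h2 : cliff n w * (cliff n w * cliff n v) = cliff n v := by
    rw [← mul_assoc, hww, one_mul]
  have h3 : cliff n w * cliff n v * cliff n x = cliff n x * (cliff n w * cliff n v) +
      ((2 * (v ⬝ᵥ x)) • cliff n w - (2 * (w ⬝ᵥ x)) • cliff n v) := by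
    rw [← map_smul, ← map_smul, ← map_sub, ← cliff_mul_cliff_comm_cliff]; abel
  have hc : Real.cos θ = 1 - 2 * Real.sin (θ / 2) ^ 2 := by
    rw [← Real.cos_sq_add_sin_sq (θ / 2)]
    nth_rw 1 [show θ = 2 * (θ / 2) by ring]
    rw [Real.cos_two_mul]
    linarith [Real.cos_sq_add_sin_sq (θ / 2)]
  have hs : Real.sin θ = 2 * Real.sin (θ / 2) * Real.cos (θ / 2) := by
    rw [← Real.sin_two_mul]; congr 1; ring
  have hcs := Real.cos_sq_add_sin_sq (θ / 2)
  rw [planeRot_mulVec, hc, hs]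
  simp only [map_add, map_smul, add_mul, mul_add, smul_mul_assoc, mul_smul_comm, one_mul, mul_one,
    h1, h2, h3]
  generalize Real.cos (θ / 2) = c at *
  generalize Real.sin (θ / 2) = s at *
  match_scalars <;> grind

theorem norm_superop_sub_one_le {J : Matrix (Qubits n) (Qubits n) ℂ} (hJ : J * J = -1)
    (hJs : star J = -J) (t : ℝ) :
    ‖superop n (Real.cos t • 1 + Real.sin t • J) - 1‖ ≤ 2 * |Real.sin t| := by
  have hJu : J ∈ unitary (Matrix (Qubits n) (Qubits n) ℂ) := by
    rw [Unitary.mem_iff, hJs, neg_mul, mul_neg, hJ, neg_neg]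
    exact ⟨rfl, rfl⟩
  set U : Matrix (Qubits n) (Qubits n) ℂ := Real.cos t • 1 + Real.sin t • J with hU
  have hUu : U ∈ unitary (Matrix (Qubits n) (Qubits n) ℂ) := by
    have h : (Real.cos t • (1 : Matrix (Qubits n) (Qubits n) ℂ) - Real.sin t • J) *
        (Real.cos t • 1 + Real.sin t • J) = 1 ∧
        (Real.cos t • 1 + Real.sin t • J) * (Real.cos t • 1 - Real.sin t • J) = 1 := by
      simp only [mul_add, add_mul, sub_mul, mul_sub, smul_mul_assoc, mul_smul_comm, one_mul,
        mul_one, hJ]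
      constructor
      all_goals
        match_scalars
        · linear_combination Real.cos_sq_add_sin_sq t
        · ring
    have hstar : star U = Real.cos t • 1 - Real.sin t • J := by
      simp [hU, hJs, sub_eq_add_neg]
    rw [Unitary.mem_iff, hstar]
    exact h
  have hmap : U.map (starRingEnd ℂ) = (star U)ᵀ := rfl
  -- Factoring out the unitary `1 ⊗ U*` leaves `U ⊗ 1 - 1 ⊗ Uᵀ`, in which the cosine terms cancel.
  -- What remains is `sin t` times a difference of two unitaries.
  have hfac : superop n U - 1 = (Real.sin t • (J ⊗ₖ 1 - 1 ⊗ₖ Jᵀ)) *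
      ((1 : Matrix (Qubits n) (Qubits n) ℂ) ⊗ₖ U.map (starRingEnd ℂ)) := by
    have h1 : Real.sin t • (J ⊗ₖ (1 : Matrix (Qubits n) (Qubits n) ℂ) - 1 ⊗ₖ Jᵀ) =
        U ⊗ₖ 1 - 1 ⊗ₖ Uᵀ := by
      rw [hU, Matrix.transpose_add, Matrix.transpose_smul, Matrix.transpose_smul,
        Matrix.transpose_one, Matrix.add_kronecker, Matrix.kronecker_add, Matrix.smul_kronecker,
        Matrix.smul_kronecker, Matrix.kronecker_smul, Matrix.kronecker_smul]
      module
    rw [h1, sub_mul, ← Matrix.mul_kronecker_mul, ← Matrix.mul_kronecker_mul, one_mul, one_mul,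
      mul_one, hmap, ← Matrix.transpose_mul, Unitary.star_mul_self_of_mem hUu,
      Matrix.transpose_one, Matrix.one_kronecker_one]
    rfl
  have hunit : (1 : Matrix (Qubits n) (Qubits n) ℂ) ⊗ₖ U.map (starRingEnd ℂ) ∈
      unitary (Matrix (Qubits n × Qubits n) (Qubits n × Qubits n) ℂ) :=
    Matrix.kronecker_mem_unitary (one_mem _) (Matrix.map_star_mem_unitaryGroup_iff.2 hUu)
  have hJ1 : ‖J ⊗ₖ (1 : Matrix (Qubits n) (Qubits n) ℂ)‖ = 1 :=
    CStarRing.norm_of_mem_unitary (Matrix.kronecker_mem_unitary hJu (one_mem _))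
  have hJ2 : ‖(1 : Matrix (Qubits n) (Qubits n) ℂ) ⊗ₖ Jᵀ‖ = 1 :=
    CStarRing.norm_of_mem_unitary (Matrix.kronecker_mem_unitary (one_mem _)
      (Matrix.transpose_mem_unitaryGroup_iff.2 hJu))
  rw [hfac, CStarRing.norm_mul_mem_unitary _ hunit, norm_smul, Real.norm_eq_abs, mul_comm]
  gcongr
  exact (norm_sub_le _ _).trans (by rw [hJ1, hJ2]; norm_num)

/-- A rotation in a plane is implemented by a matchgate which is close to the identity when the
rotation is. -/
theorem exists_spin_planeRot (hv : v ⬝ᵥ v = 1) (hw : w ⬝ᵥ w = 1) (hvw : v ⬝ᵥ w = 0) (θ : ℝ) :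
    planeRot v w θ ∈ Matrix.specialOrthogonalGroup (Fin (2 * n)) ℝ ∧
    ∃ U ∈ spin n, Implements U (planeRot v w θ) ∧
      ‖superop n U - 1‖ ≤ 2 * |Real.sin (θ / 2)| := by
  have hJ := cliff_mul_cliff_mul_self hv hw hvw
  have hexp : NormedSpace.exp (quadratic n fun j k => θ / 2 * (w j * v k)) =
      Real.cos (θ / 2) • 1 + Real.sin (θ / 2) • (cliff n w * cliff n v) := by
    rw [quadratic_eq_smul_cliff_mul_cliff hvw, exp_smul_of_mul_self_eq_neg_one hJ]
  have himp := implements_planeRot hv hw hvw θ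
  have hmem := exp_quadratic_mem_spin n fun j k => θ / 2 * (w j * v k)
  -- A matchgate implements only one matrix, so the exponential of the rotation generator is this
  -- plane rotation; its membership in SO(2n) follows.
  have hrot := (implements_exp_quadratic n fun j k => θ / 2 * (w j * v k)).eq_of_superop_eq
    (hexp ▸ himp) (spin_le_unitary n hmem) (spin_le_unitary n hmem) rfl
  rw [← hexp] at himp
  refine ⟨?_, _, hmem, himp, ?_⟩
  · rw [← hrot]
    exact exp_mem_specialOrthogonalGroup (rotQuadratic_transpose n _)
  · rw [hexp]
    exact norm_superop_sub_one_le hJ (star_cliff_mul_cliff hvw) _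

end

/-! ### Decomposition of rotations into rotations in planes -/

section

variable {m : Type*} [Fintype m] [DecidableEq m] {R : Matrix m m ℝ}

theorem mulVec_dotProduct_mulVec (hR : Rᵀ * R = 1) (x y : m → ℝ) :
    (R *ᵥ x) ⬝ᵥ (R *ᵥ y) = x ⬝ᵥ y := by
  rw [Matrix.dotProduct_mulVec, ← Matrix.mulVec_transpose, Matrix.mulVec_mulVec, hR,
    Matrix.one_mulVec]

/-- The symmetric matrix `R + Rᵀ` is diagonalizable over the reals. Were all its eigenvalues 2, it
would be `2 • 1`, so `x ⬝ᵥ R x = x ⬝ᵥ x` and hence `|R x - x|² = 0` for the basis vectors. -/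
theorem exists_eigenvector_add_transpose (hR : Rᵀ * R = 1) (h1 : R ≠ 1) :
    ∃ (v : m → ℝ) (c : ℝ), v ⬝ᵥ v = 1 ∧ c ≠ 1 ∧ R *ᵥ v + Rᵀ *ᵥ v = (2 * c) • v := by
  have hS : (R + Rᵀ).IsHermitian := by
    ext i j
    simp [Matrix.conjTranspose_apply, add_comm]
  obtain ⟨i, hi⟩ : ∃ i, hS.eigenvalues i ≠ 2 := by
    by_contra! hall
    have hS2 : R + Rᵀ = (2 : ℝ) • 1 := by
      have h := hS.spectral_theorem
      have hd : Matrix.diagonal (RCLike.ofReal ∘ hS.eigenvalues : m → ℝ) =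
          (2 : ℝ) • (1 : Matrix m m ℝ) := by
        ext a b
        simp [Matrix.diagonal_apply, Matrix.one_apply, hall]
      rw [hd, map_smul, map_one] at h
      exact h
    refine h1 (Matrix.ext_of_mulVec_single fun j => ?_)
    set x : m → ℝ := Pi.single j 1
    have hx : x ⬝ᵥ (R *ᵥ x) = x ⬝ᵥ x := by
      have h2 := congrArg (fun M => x ⬝ᵥ (M *ᵥ x)) hS2
      have h3 : x ⬝ᵥ (Rᵀ *ᵥ x) = x ⬝ᵥ (R *ᵥ x) := by
        rw [Matrix.mulVec_transpose, dotProduct_comm, Matrix.dotProduct_mulVec]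
      simp only [Matrix.add_mulVec, dotProduct_add, h3, Matrix.smul_mulVec, Matrix.one_mulVec,
        dotProduct_smul, smul_eq_mul] at h2
      linarith
    have h0 : (R *ᵥ x - x) ⬝ᵥ (R *ᵥ x - x) = 0 := by
      rw [sub_dotProduct, dotProduct_sub, dotProduct_sub, mulVec_dotProduct_mulVec hR,
        dotProduct_comm (R *ᵥ x), hx]
      ring
    rw [Matrix.one_mulVec]
    exact sub_eq_zero.1 (dotProduct_self_eq_zero.1 h0)
  refine ⟨hS.eigenvectorBasis i, hS.eigenvalues i / 2, ?_, fun h => hi (by linarith), ?_⟩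
  · have h := hS.eigenvectorBasis.orthonormal.1 i
    rw [EuclideanSpace.norm_eq, Real.sqrt_eq_one] at h
    simpa [dotProduct, sq] using h
  · rw [← Matrix.add_mulVec, hS.mulVec_eigenvectorBasis]
    congr 1
    ring

/-- Composing `R` with the reflection `H` in `v` gives an orthogonal `G` of determinant -1, which
has eigenvalue -1. As `G` fixes `v`, such an eigenvector is orthogonal to `v`, and there `G` agrees
with `R`. -/
theorem exists_orthogonal_mulVec_eq_neg (hR : Rᵀ * R = 1) (hdet : R.det = 1) {v : m → ℝ}
    (hv : v ⬝ᵥ v = 1) (hRv : R *ᵥ v = -v) :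
    ∃ w : m → ℝ, w ⬝ᵥ w = 1 ∧ v ⬝ᵥ w = 0 ∧ R *ᵥ w = -w := by
  set H : Matrix m m ℝ := 1 - (2 : ℝ) • Matrix.vecMulVec v v
  have hHx : ∀ x, H *ᵥ x = x - (2 * (v ⬝ᵥ x)) • v := fun x => by
    simp only [H, Matrix.sub_mulVec, Matrix.smul_mulVec, Matrix.vecMulVec_mulVec,
      Matrix.one_mulVec, op_smul_eq_smul, smul_smul]
  have hHdet : H.det = -1 := by
    have : H = 1 + Matrix.vecMulVec (-(2 : ℝ) • v) v := by
      rw [Matrix.smul_vecMulVec]; simp only [H]; module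
    rw [this, Matrix.vecMulVec_eq Unit, Matrix.det_one_add_replicateCol_mul_replicateRow,
      dotProduct_smul, hv]
    norm_num
  have hHt : Hᵀ = H := by simp [H, Matrix.transpose_vecMulVec]
  have hHH : H * H = 1 := by
    refine Matrix.ext_of_mulVec_single fun i => ?_
    rw [← Matrix.mulVec_mulVec, hHx, hHx, Matrix.one_mulVec, dotProduct_sub, dotProduct_smul, hv]
    simp only [smul_eq_mul]
    module
  set G := R * H
  have hG : Gᵀ * G = 1 := by
    simp only [G]
    rw [Matrix.transpose_mul, hHt, mul_assoc, ← mul_assoc Rᵀ, hR, one_mul, hHH]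
  have hd : (1 + G).det = 0 := by
    have h : Gᵀ * (1 + G) = (1 + G)ᵀ := by
      rw [mul_add, hG, mul_one, Matrix.transpose_add, Matrix.transpose_one, add_comm]
    have h := congrArg Matrix.det h
    rw [Matrix.det_mul, Matrix.det_transpose, Matrix.det_transpose] at h
    simp only [G] at h ⊢
    rw [Matrix.det_mul, hdet, hHdet] at h
    linarith
  obtain ⟨x, hx0, hx⟩ := Matrix.exists_mulVec_eq_zero_iff.2 hd
  rw [Matrix.add_mulVec, Matrix.one_mulVec] at hx
  have hGx : G *ᵥ x = -x := eq_neg_of_add_eq_zero_right hx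
  have hGv : G *ᵥ v = v := by
    simp only [G]
    rw [← Matrix.mulVec_mulVec, hHx, hv, Matrix.mulVec_sub, Matrix.mulVec_smul, hRv]
    module
  have hvx : v ⬝ᵥ x = 0 := by
    have h := mulVec_dotProduct_mulVec hG v x
    rw [hGv, hGx, dotProduct_neg] at h
    linarith
  have hRx : R *ᵥ x = -x := by
    rw [← hGx]
    simp only [G]
    rw [← Matrix.mulVec_mulVec, hHx, hvx, mul_zero, zero_smul, sub_zero]
  have hxx : 0 < x ⬝ᵥ x := by
    have h : 0 ≤ x ⬝ᵥ x := Finset.sum_nonneg fun i _ => mul_self_nonneg _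
    exact h.lt_of_ne fun h => hx0 (dotProduct_self_eq_zero.1 h.symm)
  refine ⟨(Real.sqrt (x ⬝ᵥ x))⁻¹ • x, ?_, ?_, ?_⟩
  · rw [dotProduct_smul, smul_dotProduct, smul_eq_mul, smul_eq_mul, ← mul_assoc, ← mul_inv,
      Real.mul_self_sqrt hxx.le, inv_mul_cancel₀ hxx.ne']
  · rw [dotProduct_smul, hvx, smul_zero]
  · rw [Matrix.mulVec_smul, hRx, smul_neg]

/-- A rotation other than the identity rotates some plane nontrivially. -/
theorem exists_invariant_plane (hR : Rᵀ * R = 1) (hdet : R.det = 1) (h1 : R ≠ 1) :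
    ∃ (v w : m → ℝ) (θ : ℝ), v ⬝ᵥ v = 1 ∧ w ⬝ᵥ w = 1 ∧ v ⬝ᵥ w = 0 ∧ Real.cos θ ≠ 1 ∧
      R *ᵥ v = Real.cos θ • v + Real.sin θ • w ∧ R *ᵥ w = Real.cos θ • w - Real.sin θ • v := by
  obtain ⟨v, c, hv, hc1, hS⟩ := exists_eigenvector_add_transpose hR h1
  have hvR : v ⬝ᵥ (R *ᵥ v) = c := by
    have h := congrArg (v ⬝ᵥ ·) hS
    have h3 : v ⬝ᵥ (Rᵀ *ᵥ v) = v ⬝ᵥ (R *ᵥ v) := by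
      rw [Matrix.mulVec_transpose, dotProduct_comm, Matrix.dotProduct_mulVec]
    simp only [dotProduct_add, h3, dotProduct_smul, hv, smul_eq_mul] at h
    linarith
  -- Hence the span of `v` and `R v` is invariant. It is a plane unless `c = -1`, the case in which
  -- the determinant is needed to supply a second vector.
  have hRR : R *ᵥ (R *ᵥ v) = (2 * c) • (R *ᵥ v) - v := by
    have h := congrArg (R *ᵥ ·) hS
    simp only [Matrix.mulVec_add, Matrix.mulVec_smul, Matrix.mulVec_mulVec] at h
    rw [mul_eq_one_comm.1 hR, Matrix.one_mulVec] at h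
    rw [← h, Matrix.mulVec_mulVec]
    abel
  have hsq : (R *ᵥ v - c • v) ⬝ᵥ (R *ᵥ v - c • v) = 1 - c ^ 2 := by
    simp only [sub_dotProduct, dotProduct_sub, mulVec_dotProduct_mulVec hR, smul_dotProduct,
      dotProduct_smul, dotProduct_comm (R *ᵥ v) v, hvR, hv, smul_eq_mul]
    ring
  have hnn : 0 ≤ 1 - c ^ 2 := hsq ▸ Finset.sum_nonneg fun i _ => mul_self_nonneg _
  rcases hnn.eq_or_lt with h0 | hpos
  · have hc : c = -1 := by
      rcases mul_self_eq_one_iff.1 (by linarith : c * c = 1) with h | h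
      · exact absurd h hc1
      · exact h
    have hRv : R *ᵥ v = -v := by
      rw [← h0] at hsq
      rw [sub_eq_zero.1 (dotProduct_self_eq_zero.1 hsq), hc, neg_one_smul]
    obtain ⟨w, hw, hvw, hRw⟩ := exists_orthogonal_mulVec_eq_neg hR hdet hv hRv
    exact ⟨v, w, Real.pi, hv, hw, hvw, by norm_num, by simp [hRv], by simp [hRw]⟩
  · have hcos : Real.cos (Real.arccos c) = c := Real.cos_arccos (by nlinarith) (by nlinarith)
    have hsin : Real.sin (Real.arccos c) = Real.sqrt (1 - c ^ 2) := Real.sin_arccos c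
    set s := Real.sqrt (1 - c ^ 2) with hs
    have hs0 : s ≠ 0 := (Real.sqrt_pos.2 hpos).ne'
    have hss : s * s = 1 - c ^ 2 := Real.mul_self_sqrt hnn
    refine ⟨v, s⁻¹ • (R *ᵥ v - c • v), Real.arccos c, hv, ?_, ?_, by rwa [hcos], ?_, ?_⟩
    · rw [dotProduct_smul, smul_dotProduct, hsq, smul_eq_mul, smul_eq_mul, ← hss]
      field_simp
    · rw [dotProduct_smul, dotProduct_sub, dotProduct_smul, hvR, hv]
      simp
    · rw [hcos, hsin, smul_smul, mul_inv_cancel₀ hs0]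
      module
    · rw [hcos, hsin, Matrix.mulVec_smul, Matrix.mulVec_sub, Matrix.mulVec_smul, hRR]
      match_scalars
      · field_simp; ring
      · field_simp; linear_combination hss

variable {v w : m → ℝ} {θ : ℝ}

/-- Invariance of the inner product gives a linear system for `v ⬝ᵥ x` and `w ⬝ᵥ x` with determinant
`(1 - cos θ)² + sin² θ = 2 (1 - cos θ)`, nonzero here. -/
theorem dotProduct_eq_zero_of_fixed (hR : Rᵀ * R = 1) (hθ : Real.cos θ ≠ 1)
    (hRv : R *ᵥ v = Real.cos θ • v + Real.sin θ • w)
    (hRw : R *ᵥ w = Real.cos θ • w - Real.sin θ • v) {x : m → ℝ} (hx : R *ᵥ x = x) :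
    v ⬝ᵥ x = 0 ∧ w ⬝ᵥ x = 0 := by
  have h1 := mulVec_dotProduct_mulVec hR v x
  have h2 := mulVec_dotProduct_mulVec hR w x
  rw [hRv, hx, add_dotProduct, smul_dotProduct, smul_dotProduct, smul_eq_mul, smul_eq_mul] at h1
  rw [hRw, hx, sub_dotProduct, smul_dotProduct, smul_dotProduct, smul_eq_mul, smul_eq_mul] at h2
  have hcs := Real.cos_sq_add_sin_sq θ
  have hne : 2 * (1 - Real.cos θ) ≠ 0 := mul_ne_zero two_ne_zero (sub_ne_zero.2 (Ne.symm hθ))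
  constructor
  · refine (mul_eq_zero.1 (?_ : 2 * (1 - Real.cos θ) * (v ⬝ᵥ x) = 0)).resolve_left hne
    linear_combination (Real.cos θ - 1) * h1 - Real.sin θ * h2 - (v ⬝ᵥ x) * hcs
  · refine (mul_eq_zero.1 (?_ : 2 * (1 - Real.cos θ) * (w ⬝ᵥ x) = 0)).resolve_left hne
    linear_combination (Real.cos θ - 1) * h2 + Real.sin θ * h1 - (w ⬝ᵥ x) * hcs

/-- For an orthonormal pair the last factor is the projection onto the complement of the plane. This
form shows both that the norm does not grow and that the plane becomes fixed. -/
theorem mul_planeRot_sub_one (hRv : R *ᵥ v = Real.cos θ • v + Real.sin θ • w)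
    (hRw : R *ᵥ w = Real.cos θ • w - Real.sin θ • v) :
    R * planeRot v w (-θ) - 1 =
      (R - 1) * (1 - (Matrix.vecMulVec v v + Matrix.vecMulVec w w)) := by
  refine Matrix.ext_of_mulVec_single fun i => ?_
  have hcs := Real.cos_sq_add_sin_sq θ
  simp only [Matrix.sub_mulVec, ← Matrix.mulVec_mulVec, planeRot_mulVec, Matrix.mulVec_add,
    Matrix.mulVec_sub, Matrix.mulVec_smul, hRv, hRw, Matrix.one_mulVec, Matrix.add_mulVec,
    Matrix.vecMulVec_mulVec, op_smul_eq_smul, Real.cos_neg, Real.sin_neg]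
  match_scalars <;> grind

theorem norm_one_sub_vecMulVec_le (hv : v ⬝ᵥ v = 1) (hw : w ⬝ᵥ w = 1) (hvw : v ⬝ᵥ w = 0) :
    ‖(1 : Matrix m m ℝ) - (Matrix.vecMulVec v v + Matrix.vecMulVec w w)‖ ≤ 1 := by
  refine IsStarProjection.norm_le _ (IsStarProjection.one_sub ⟨?_, ?_⟩)
  · have hwv : w ⬝ᵥ v = 0 := by rw [dotProduct_comm, hvw]
    simp [IsIdempotentElem, mul_add, add_mul, Matrix.vecMulVec_mul_vecMulVec, hv, hw, hvw, hwv]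
  · ext i j
    simp [Matrix.vecMulVec_apply, mul_comm]

theorem two_mul_abs_sin_half_le_norm (hv : v ⬝ᵥ v = 1) (hw : w ⬝ᵥ w = 1) (hvw : v ⬝ᵥ w = 0)
    (hRv : R *ᵥ v = Real.cos θ • v + Real.sin θ • w) : 2 * |Real.sin (θ / 2)| ≤ ‖R - 1‖ := by
  have h : ‖WithLp.toLp 2 ((R - 1) *ᵥ v)‖ ≤ ‖R - 1‖ * ‖WithLp.toLp 2 v‖ :=
    Matrix.l2_opNorm_mulVec (R - 1) (WithLp.toLp 2 v)
  have hn : ∀ y : m → ℝ, ‖WithLp.toLp 2 y‖ = Real.sqrt (y ⬝ᵥ y) := fun y => by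
    rw [EuclideanSpace.norm_eq]
    simp [dotProduct, sq]
  have hd : ((R - 1) *ᵥ v) ⬝ᵥ ((R - 1) *ᵥ v) = (2 * |Real.sin (θ / 2)|) ^ 2 := by
    have hc : Real.cos θ = 1 - 2 * Real.sin (θ / 2) ^ 2 := by
      rw [Real.sin_sq_eq_half_sub]; ring_nf
    rw [mul_pow, sq_abs, Matrix.sub_mulVec, Matrix.one_mulVec, hRv]
    simp only [sub_dotProduct, dotProduct_sub, add_dotProduct, dotProduct_add, smul_dotProduct,
      dotProduct_smul, hv, hw, hvw, dotProduct_comm w v, smul_eq_mul]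
    have hcs := Real.cos_sq_add_sin_sq θ
    linear_combination hcs - 2 * hc
  simp only [hn, hd, hv, Real.sqrt_one, mul_one] at h
  rwa [Real.sqrt_sq (by positivity)] at h

/-- Vectors fixed by `R` are orthogonal to the plane, so they stay fixed and meet it only in 0; the
plane itself becomes fixed. -/
theorem finrank_fixed_mul_planeRot (hR : Rᵀ * R = 1) (hv : v ⬝ᵥ v = 1) (hw : w ⬝ᵥ w = 1)
    (hvw : v ⬝ᵥ w = 0) (hθ : Real.cos θ ≠ 1)
    (hRv : R *ᵥ v = Real.cos θ • v + Real.sin θ • w)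
    (hRw : R *ᵥ w = Real.cos θ • w - Real.sin θ • v) :
    Module.finrank ℝ (LinearMap.ker (R - 1).mulVecLin) + 2 ≤
      Module.finrank ℝ (LinearMap.ker (R * planeRot v w (-θ) - 1).mulVecLin) := by
  have hwv : w ⬝ᵥ v = 0 := by rw [dotProduct_comm, hvw]
  have hmem : ∀ x, x ∈ LinearMap.ker (R - 1).mulVecLin → v ⬝ᵥ x = 0 ∧ w ⬝ᵥ x = 0 := by
    intro x hx
    rw [LinearMap.mem_ker, Matrix.mulVecLin_apply, Matrix.sub_mulVec, Matrix.one_mulVec,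
      sub_eq_zero] at hx
    exact dotProduct_eq_zero_of_fixed hR hθ hRv hRw hx
  have hspan : Module.finrank ℝ (Submodule.span ℝ (Set.range ![v, w])) = 2 := by
    have hli : LinearIndependent ℝ ![v, w] := by
      rw [LinearIndependent.pair_iff]
      intro a b hab
      have h1 := congrArg (v ⬝ᵥ ·) hab
      have h2 := congrArg (w ⬝ᵥ ·) hab
      simp only [dotProduct_add, dotProduct_smul, hv, hw, hvw, hwv, dotProduct_zero] at h1 h2
      simpa using And.intro h1 h2
    simpa using finrank_span_eq_card hli
  have hinf : LinearMap.ker (R - 1).mulVecLin ⊓ Submodule.span ℝ (Set.range ![v, w]) = ⊥ := by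
    rw [eq_bot_iff]
    rintro x ⟨hx, hxs⟩
    obtain ⟨h1, h2⟩ := hmem x hx
    simp only [Matrix.range_cons, Matrix.range_empty, Set.union_empty, Set.singleton_union,
      SetLike.mem_coe, Submodule.mem_span_pair] at hxs
    obtain ⟨a, b, rfl⟩ := hxs
    simp only [dotProduct_add, dotProduct_smul, hv, hw, hvw, hwv, smul_eq_mul, mul_one, mul_zero,
      add_zero, zero_add] at h1 h2
    simp [h1, h2]
  have hle : LinearMap.ker (R - 1).mulVecLin ⊔ Submodule.span ℝ (Set.range ![v, w]) ≤
      LinearMap.ker (R * planeRot v w (-θ) - 1).mulVecLin := by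
    rw [mul_planeRot_sub_one hRv hRw]
    refine sup_le (fun x hx => ?_) (Submodule.span_le.2 ?_)
    · obtain ⟨h1, h2⟩ := hmem x hx
      rw [LinearMap.mem_ker, Matrix.mulVecLin_apply] at hx ⊢
      rw [← Matrix.mulVec_mulVec, Matrix.sub_mulVec 1, Matrix.one_mulVec, Matrix.add_mulVec,
        Matrix.vecMulVec_mulVec, Matrix.vecMulVec_mulVec, h1, h2]
      simpa using hx
    · have key : ∀ x, (Matrix.vecMulVec v v + Matrix.vecMulVec w w) *ᵥ x = x →
          x ∈ LinearMap.ker ((R - 1) *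
            (1 - (Matrix.vecMulVec v v + Matrix.vecMulVec w w))).mulVecLin := by
        intro x hx
        rw [LinearMap.mem_ker, Matrix.mulVecLin_apply, ← Matrix.mulVec_mulVec,
          Matrix.sub_mulVec 1, Matrix.one_mulVec, hx, sub_self, Matrix.mulVec_zero]
      rw [Set.range_subset_iff, Fin.forall_fin_two]
      constructor <;> refine key _ ?_ <;>
        simp [Matrix.add_mulVec, Matrix.vecMulVec_mulVec, hv, hw, hvw, hwv]
  have h := Submodule.finrank_sup_add_finrank_inf_eq (LinearMap.ker (R - 1).mulVecLin)
    (Submodule.span ℝ (Set.range ![v, w]))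
  rw [hinf, hspan, finrank_bot, add_zero] at h
  rw [← h]
  exact Submodule.finrank_mono hle

end

theorem exists_spin_of_finrank_fixed {n : ℕ} (k : ℕ) (R : Matrix (Fin (2 * n)) (Fin (2 * n)) ℝ)
    (hR : R ∈ Matrix.specialOrthogonalGroup (Fin (2 * n)) ℝ)
    (hk : 2 * n ≤ Module.finrank ℝ (LinearMap.ker (R - 1).mulVecLin) + 2 * k) :
    ∃ U ∈ spin n, Implements U R ∧ ‖superop n U - 1‖ ≤ k * ‖R - 1‖ := by
  induction k generalizing R with
  | zero =>
    have htop : LinearMap.ker (R - 1).mulVecLin = ⊤ := by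
      refine Submodule.eq_top_of_finrank_eq (le_antisymm (Submodule.finrank_le _) ?_)
      simpa using hk
    have h1 : R = 1 := by
      refine Matrix.ext_of_mulVec_single fun i => ?_
      have h : Pi.single i 1 ∈ LinearMap.ker (R - 1).mulVecLin := htop ▸ Submodule.mem_top
      rwa [LinearMap.mem_ker, Matrix.mulVecLin_apply, Matrix.sub_mulVec, sub_eq_zero] at h
    exact ⟨1, one_mem _, h1 ▸ .one, by simp⟩
  | succ k ih =>
    by_cases h1 : R = 1
    · exact ⟨1, one_mem _, h1 ▸ .one, by simp only [map_one, sub_self, norm_zero]; positivity⟩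
    obtain ⟨horth, hdet⟩ := Matrix.mem_specialOrthogonalGroup_iff.1 hR
    have hRR : Rᵀ * R = 1 := (Matrix.mem_orthogonalGroup_iff' _ _).1 horth
    obtain ⟨v, w, θ, hv, hw, hvw, hθ, hRv, hRw⟩ := exists_invariant_plane hRR hdet h1
    have hrank := finrank_fixed_mul_planeRot hRR hv hw hvw hθ hRv hRw
    obtain ⟨hP', -⟩ := exists_spin_planeRot hv hw hvw (-θ)
    obtain ⟨hP, V, hV, hVP, hVn⟩ := exists_spin_planeRot hv hw hvw θ
    obtain ⟨U, hU, hUR, hUn⟩ := ih (R * planeRot v w (-θ)) (mul_mem hR hP') (by omega)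
    have hcancel : R * planeRot v w (-θ) * planeRot v w θ = R := by
      rw [mul_assoc, ← planeRot_transpose, (Matrix.mem_orthogonalGroup_iff' _ _).1
        (Matrix.mem_specialOrthogonalGroup_iff.1 hP).1, mul_one]
    have hnorm : ‖R * planeRot v w (-θ) - 1‖ ≤ ‖R - 1‖ := by
      rw [mul_planeRot_sub_one hRv hRw]
      exact (norm_mul_le _ _).trans
        (mul_le_of_le_one_right (norm_nonneg _) (norm_one_sub_vecMulVec_le hv hw hvw))
    refine ⟨U * V, mul_mem hU hV, hcancel ▸ hUR.mul hVP, ?_⟩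
    -- Telescoping: multiplying by the unitary `superop n V` preserves the norm, so the distances to
    -- the identity add.
    have hsplit : superop n (U * V) - 1 =
        (superop n U - 1) * superop n V + (superop n V - 1) := by
      rw [map_mul]; noncomm_ring
    calc ‖superop n (U * V) - 1‖
        ≤ ‖(superop n U - 1) * superop n V‖ + ‖superop n V - 1‖ := by
          rw [hsplit]; exact norm_add_le _ _
      _ = ‖superop n U - 1‖ + ‖superop n V - 1‖ := by
          rw [CStarRing.norm_mul_mem_unitary _ (superop_mem_unitary (spin_le_unitary n hV))]
      _ ≤ k * ‖R - 1‖ + ‖R - 1‖ := by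
          refine add_le_add (hUn.trans ?_)
            (hVn.trans (two_mul_abs_sin_half_le_norm hv hw hvw hRv))
          gcongr
      _ = (k + 1 : ℕ) * ‖R - 1‖ := by push_cast; ring

/-- Every rotation is implemented by a matchgate whose superoperator is close to the identity
when the rotation is. -/
theorem exists_spin_norm_le {n : ℕ} {R : Matrix (Fin (2 * n)) (Fin (2 * n)) ℝ}
    (hR : R ∈ Matrix.specialOrthogonalGroup (Fin (2 * n)) ℝ) :
    ∃ U ∈ spin n, Implements U R ∧ ‖superop n U - 1‖ ≤ n * ‖R - 1‖ :=
  -- With `k = n` the dimension hypothesis holds even for a trivial fixed space.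
  exists_spin_of_finrank_fixed n R hR (by omega)

/-! ### The isomorphism between `Ad_{SPIN(2n)}` and `SO(2n)` -/

theorem existsUnique_rotation {n : ℕ} (W : adSpin n) :
    ∃! Q : Matrix.specialOrthogonalGroup (Fin (2 * n)) ℝ,
      ∃ U ∈ spin n, superop n U = W ∧ Implements U Q := by
  obtain ⟨U, hU, hUW⟩ := Submonoid.mem_map.1 W.2
  obtain ⟨Q, hQ, hUQ⟩ := exists_implements_of_mem_spin hU
  refine ⟨⟨Q, hQ⟩, ⟨U, hU, hUW, hUQ⟩, ?_⟩
  rintro ⟨R, hR⟩ ⟨V, hV, hVW, hVR⟩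
  exact Subtype.ext (hVR.eq_of_superop_eq hUQ (spin_le_unitary n hV) (spin_le_unitary n hU)
    (hVW.trans hUW.symm))

/-- The rotation of the Majorana operators induced by a superoperator. -/
noncomputable def rotation {n : ℕ} (W : adSpin n) :
    Matrix.specialOrthogonalGroup (Fin (2 * n)) ℝ :=
  (existsUnique_rotation W).choose

theorem rotation_eq_iff {n : ℕ} (W : adSpin n)
    (Q : Matrix.specialOrthogonalGroup (Fin (2 * n)) ℝ) :
    rotation W = Q ↔ ∃ U ∈ spin n, superop n U = W ∧ Implements U Q := by
  have h := (existsUnique_rotation W).choose_spec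
  exact ⟨fun hQ => hQ ▸ h.1, fun hQ => (h.2 Q hQ).symm⟩

theorem rotation_mul {n : ℕ} (W W' : adSpin n) : rotation (W * W') = rotation W * rotation W' := by
  obtain ⟨U, hU, hUW, hUQ⟩ := (rotation_eq_iff W _).1 rfl
  obtain ⟨V, hV, hVW, hVQ⟩ := (rotation_eq_iff W' _).1 rfl
  exact (rotation_eq_iff _ _).2
    ⟨U * V, mul_mem hU hV, by rw [map_mul, hUW, hVW]; rfl, hUQ.mul hVQ⟩

theorem rotation_bijective (n : ℕ) : Function.Bijective (rotation (n := n)) := by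
  constructor
  · intro W W' h
    obtain ⟨U, hU, hUW, hUQ⟩ := (rotation_eq_iff W _).1 rfl
    obtain ⟨V, hV, hVW, hVQ⟩ := (rotation_eq_iff W' _).1 rfl
    rw [h] at hUQ
    exact Subtype.ext (hUW.symm.trans ((hUQ.superop_eq_of_eq hVQ (spin_le_unitary n hU)
      (spin_le_unitary n hV)).trans hVW))
  · intro Q
    obtain ⟨U, hU, hUQ, -⟩ := exists_spin_norm_le Q.2
    exact ⟨⟨superop n U, Submonoid.mem_map_of_mem _ hU⟩,
      (rotation_eq_iff _ _).2 ⟨U, hU, rfl, hUQ⟩⟩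

/-- The isomorphism `Φ` from `Ad_{SPIN(2n)}` to `SO(2n)`. -/
noncomputable def rotationEquiv (n : ℕ) :
    adSpin n ≃* Matrix.specialOrthogonalGroup (Fin (2 * n)) ℝ :=
  { Equiv.ofBijective _ (rotation_bijective n) with map_mul' := rotation_mul }

theorem rotationEquiv_adExp (n : ℕ) (α : Fin (2 * n) → Fin (2 * n) → ℝ) :
    rotationEquiv n (adExp n α) =
      ⟨_, exp_mem_specialOrthogonalGroup (rotQuadratic_transpose n α)⟩ :=
  (rotation_eq_iff _ _).2 ⟨_, exp_quadratic_mem_spin n α, rfl, implements_exp_quadratic n α⟩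

theorem isPhi_rotationEquiv (n : ℕ) : IsPhi n (rotationEquiv n) := fun α => by
  rw [rotationEquiv_adExp]

theorem IsPhi.eq_rotationEquiv {n : ℕ}
    {Φ : adSpin n ≃* Matrix.specialOrthogonalGroup (Fin (2 * n)) ℝ} (hΦ : IsPhi n Φ) :
    Φ = rotationEquiv n := by
  have key : ∀ (U : Matrix (Qubits n) (Qubits n) ℂ) (hU : U ∈ spin n),
      Φ ⟨superop n U, Submonoid.mem_map_of_mem _ hU⟩ =
        rotationEquiv n ⟨superop n U, Submonoid.mem_map_of_mem _ hU⟩ := by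
    intro U hU
    induction hU using Submonoid.closure_induction with
    | mem U hU =>
      obtain ⟨α, rfl⟩ := hU
      exact Subtype.ext ((hΦ α).trans (isPhi_rotationEquiv n α).symm)
    | one =>
      have h : (⟨superop n 1, Submonoid.mem_map_of_mem _ (one_mem _)⟩ : adSpin n) = 1 :=
        Subtype.ext (map_one _)
      rw [h, map_one, map_one]
    | mul U V hU hV ihU ihV =>
      have h : (⟨superop n (U * V), Submonoid.mem_map_of_mem _ (mul_mem hU hV)⟩ : adSpin n) =
          ⟨superop n U, Submonoid.mem_map_of_mem _ hU⟩ *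
            ⟨superop n V, Submonoid.mem_map_of_mem _ hV⟩ :=
        Subtype.ext (map_mul _ _ _)
      rw [h, map_mul, map_mul, ihU, ihV]
  ext1 W
  obtain ⟨U, hU, hUW⟩ := Submonoid.mem_map.1 W.2
  obtain rfl : (⟨superop n U, Submonoid.mem_map_of_mem _ hU⟩ : adSpin n) = W := Subtype.ext hUW
  exact key U hU

/-! ### The Lipschitz estimate for the inverse isomorphism -/

theorem norm_rotationEquiv_symm_sub_one_le {n : ℕ}
    (R : Matrix.specialOrthogonalGroup (Fin (2 * n)) ℝ) :
    ‖((rotationEquiv n).symm R :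
        Matrix (Qubits n × Qubits n) (Qubits n × Qubits n) ℂ) - 1‖ ≤
      n * ‖(R : Matrix (Fin (2 * n)) (Fin (2 * n)) ℝ) - 1‖ := by
  obtain ⟨U, hU, hUR, hn⟩ := exists_spin_norm_le R.2
  have h : (rotationEquiv n).symm R = ⟨superop n U, Submonoid.mem_map_of_mem _ hU⟩ :=
    (MulEquiv.symm_apply_eq _).2 ((rotation_eq_iff _ _).2 ⟨U, hU, rfl, hUR⟩).symm
  rw [h]
  exact hn

theorem adSpin_le_unitary (n : ℕ) :
    adSpin n ≤ unitary (Matrix (Qubits n × Qubits n) (Qubits n × Qubits n) ℂ) := by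
  rintro _ ⟨U, hU, rfl⟩
  exact superop_mem_unitary (spin_le_unitary n hU)

theorem norm_rotationEquiv_symm_sub_le {n : ℕ}
    (Q R : Matrix.specialOrthogonalGroup (Fin (2 * n)) ℝ) :
    ‖((rotationEquiv n).symm Q : Matrix (Qubits n × Qubits n) (Qubits n × Qubits n) ℂ) -
        ((rotationEquiv n).symm R : Matrix (Qubits n × Qubits n) (Qubits n × Qubits n) ℂ)‖ ≤
      n * ‖(Q : Matrix (Fin (2 * n)) (Fin (2 * n)) ℝ) -
        (R : Matrix (Fin (2 * n)) (Fin (2 * n)) ℝ)‖ := by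
  have hinv : ∀ S : Matrix.specialOrthogonalGroup (Fin (2 * n)) ℝ,
      (S : Matrix (Fin (2 * n)) (Fin (2 * n)) ℝ) ∈ unitary (Matrix (Fin (2 * n)) (Fin (2 * n)) ℝ) :=
    fun S => S.2.1
  -- Right translation by `R` is an isometry on both sides, so only the distance of `Q * R⁻¹` to the
  -- identity matters.
  have hQ : (rotationEquiv n).symm Q =
      (rotationEquiv n).symm (Q * R⁻¹) * (rotationEquiv n).symm R := by
    rw [← map_mul, inv_mul_cancel_right]
  have hdiff : ((rotationEquiv n).symm Q :
        Matrix (Qubits n × Qubits n) (Qubits n × Qubits n) ℂ) - (rotationEquiv n).symm R =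
      (((rotationEquiv n).symm (Q * R⁻¹) :
        Matrix (Qubits n × Qubits n) (Qubits n × Qubits n) ℂ) - 1) *
        (rotationEquiv n).symm R := by
    rw [hQ, Submonoid.coe_mul, sub_mul, one_mul]
  have hdiff' : (Q : Matrix (Fin (2 * n)) (Fin (2 * n)) ℝ) - R =
      (((Q * R⁻¹ : Matrix.specialOrthogonalGroup (Fin (2 * n)) ℝ) :
        Matrix (Fin (2 * n)) (Fin (2 * n)) ℝ) - 1) * R := by
    rw [sub_mul, one_mul, ← Submonoid.coe_mul, inv_mul_cancel_right]
  rw [hdiff, hdiff', CStarRing.norm_mul_mem_unitary _ (adSpin_le_unitary n (Subtype.prop _)),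
    CStarRing.norm_mul_mem_unitary _ (hinv R)]
  exact norm_rotationEquiv_symm_sub_one_le _

end Matchgate

/-- Norms of matrices are operator norms for the Euclidean norm. -/
theorem theorem2 (n : ℕ) :
    (∃! Φ : Matchgate.adSpin n ≃* Matrix.specialOrthogonalGroup (Fin (2 * n)) ℝ,
      Matchgate.IsPhi n Φ) ∧
    ∀ Φ : Matchgate.adSpin n ≃* Matrix.specialOrthogonalGroup (Fin (2 * n)) ℝ,
      Matchgate.IsPhi n Φ →
      ∀ (Q Qε : Matrix.specialOrthogonalGroup (Fin (2 * n)) ℝ) (ε : ℝ),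
        ‖(Q : Matrix (Fin (2 * n)) (Fin (2 * n)) ℝ)
            - (Qε : Matrix (Fin (2 * n)) (Fin (2 * n)) ℝ)‖ = ε →
        ‖(Φ.symm Q : Matrix (Matchgate.Qubits n × Matchgate.Qubits n)
              (Matchgate.Qubits n × Matchgate.Qubits n) ℂ)
            - (Φ.symm Qε : Matrix (Matchgate.Qubits n × Matchgate.Qubits n)
              (Matchgate.Qubits n × Matchgate.Qubits n) ℂ)‖
          ≤ Real.pi / 2 * n * ε := by
  refine ⟨⟨Matchgate.rotationEquiv n, Matchgate.isPhi_rotationEquiv n,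
    fun Φ hΦ => Matchgate.IsPhi.eq_rotationEquiv hΦ⟩, ?_⟩
  rintro Φ hΦ Q Qε ε rfl
  rw [hΦ.eq_rotationEquiv]
  refine (Matchgate.norm_rotationEquiv_symm_sub_le Q Qε).trans ?_
  refine mul_le_mul_of_nonneg_right ?_ (norm_nonneg _)
  -- Only `1 ≤ π/2` is used: the bound already holds with constant `n`.
  exact le_mul_of_one_le_left n.cast_nonneg (by linarith [Real.pi_gt_three])
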